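/- Let $L,h,\lambda_1,\lambda_2>0$, let $\Omega=(-2L,2L)$, and let $f=h$ on $[-L,L]$ and $f=0$ on $\Omega\setminus[-L,L]$. Consider the problem $$\min_{u\in BV(\Omega)}\ |Du|(\Omega)+\Phi(u,f),\qquad \Phi(u,f)=\inf_{v\in L^1(\Omega)}\ \lambda_1\|v\|_{L^1(\Omega)}+\frac{\lambda_2}{2}\|f-u-v\|_{L^2(\Omega)}^2,$$ where $|Du|(\Omega)$ is the total variation of the distributional derivative of $u$, and functions are identified when they agree almost everywhere on $\Omega$. Its solutions are as follows. (i) If $\frac h2<\frac{\lambda_1}{\lambda_2}$ and $\lambda_2\le\frac{2}{hL}$, then the solution is unique and equal to the constant $u=\frac h2$. (ii) If $\frac h2\ge\frac{\lambda_1}{\lambda_2}$ and $\lambda_1<\frac1L$, then the solutions are exactly the constants $u=c$ with $\frac{\lambda_1}{\lambda_2}\le c\le h-\frac{\lambda_1}{\lambda_2}$; in particular a solution exists, and there are infinitely many if $\frac h2>\frac{\lambda_1}{\lambda_2}$. (iii) If $\frac h2\ge\frac{\lambda_1}{\lambda_2}$ and $\lambda_1=\frac1L$, then the solutions are exactly the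 functions with $u=c_1$ on $(-2L,-L)$, $u=h-d$ on $[-L,L]$ and $u=c_2$ on $(L,2L)$, where $c_1,c_2,d\in\mathbb R$ satisfy $\frac{\lambda_1}{\lambda_2}\le c_i\le h-d\le h-\frac{\lambda_1}{\lambda_2}$ for $i=1,2$; in particular a solution exists, and there are infinitely many if $\frac h2>\frac{\lambda_1}{\lambda_2}$. (iv) If $\lambda_2>\frac{2}{hL}$ and $\lambda_1>\frac1L$, then the solution is unique and given by $u=\frac{1}{L\lambda_2}$ on $(-2L,-L)\cup(L,2L)$ and $u=h-\frac{1}{L\lambda_2}$ on $[-L,L]$. -/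

import Mathlib

open MeasureTheory Set Filter
open scoped ContDiff

noncomputable section

namespace TVIC

/-- Smooth, compactly supported test functions on the open set `Ω ⊆ ℝ`. -/
def IsTestFunction (Ω : Set ℝ) (φ : ℝ → ℝ) : Prop :=
  ContDiff ℝ ∞ φ ∧ HasCompactSupport φ ∧ tsupport φ ⊆ Ω

/-- The integral of a function against a finite signed measure, through the Jordan
decomposition `μ = μ⁺ - μ⁻`. -/
def signedIntegral (μ : SignedMeasure ℝ) (φ : ℝ → ℝ) : ℝ :=
  (∫ x, φ x ∂μ.toJordanDecomposition.posPart) - ∫ x, φ x ∂μ.toJordanDecomposition.negPart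

/-- The finite signed measure `μ` is, on `Ω`, the distributional derivative `Du` of `u`. Only the
values of `μ` on subsets of `Ω` matter. -/
def IsDistribDeriv (Ω : Set ℝ) (u : ℝ → ℝ) (μ : SignedMeasure ℝ) : Prop :=
  ∀ φ : ℝ → ℝ, IsTestFunction Ω φ → ∫ x in Ω, u x * deriv φ x = -signedIntegral μ φ

/-- `u ∈ BV(Ω)`: `u` is integrable on `Ω` and its distributional derivative is a finite signed
measure. -/
def IsBV (Ω : Set ℝ) (u : ℝ → ℝ) : Prop :=
  MemLp u 1 (volume.restrict Ω) ∧ ∃ μ : SignedMeasure ℝ, IsDistribDeriv Ω u μ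

/-- The total variation `|Du|(Ω)` of the measure `Du` (and `⊤` if `Du` is not a measure). The
infimum only serves to pick the number `|μ|(Ω)`, where `μ` is the distributional derivative: see
`variation_eq`. -/
def variation (Ω : Set ℝ) (u : ℝ → ℝ) : ENNReal :=
  ⨅ (μ : SignedMeasure ℝ) (_ : IsDistribDeriv Ω u μ), μ.totalVariation Ω

/-- The `L¹`-`L²` infimal convolution fidelity
`Φ(u, f) = inf_{v ∈ L¹(Ω)} l₁ ‖v‖_{L¹(Ω)} + (l₂ / 2) ‖f - u - v‖²_{L²(Ω)}`, where the `L²` norm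
of a function outside `L²(Ω)` is `⊤`. -/
def fidelity (Ω : Set ℝ) (l₁ l₂ : ℝ) (u f : ℝ → ℝ) : ENNReal :=
  ⨅ (v : ℝ → ℝ) (_ : MemLp v 1 (volume.restrict Ω)),
    ENNReal.ofReal l₁ * eLpNorm v 1 (volume.restrict Ω) +
      ENNReal.ofReal (l₂ / 2) * eLpNorm (fun x => f x - u x - v x) 2 (volume.restrict Ω) ^ 2

/-- The energy `|Du|(Ω) + Φ(u, f)`. -/
def energy (Ω : Set ℝ) (l₁ l₂ : ℝ) (f u : ℝ → ℝ) : ENNReal :=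
  variation Ω u + fidelity Ω l₁ l₂ u f

/-- The set of all solutions of `min_{u ∈ BV(Ω)} |Du|(Ω) + Φ(u, f)`, as a set of elements of
`L¹(Ω)`, that is, of functions modulo equality almost everywhere on `Ω`. -/
def solutions (Ω : Set ℝ) (l₁ l₂ : ℝ) (f : ℝ → ℝ) : Set (Lp ℝ 1 (volume.restrict Ω)) :=
  {u | IsBV Ω u ∧ ∀ w : ℝ → ℝ, IsBV Ω w → energy Ω l₁ l₂ f u ≤ energy Ω l₁ l₂ f w}

/-- The domain `(-2L, 2L)`. -/
def dom (L : ℝ) : Set ℝ := Ioo (-2 * L) (2 * L)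

/-- The step function with value `a` left of `-L`, `b` on `[-L, L]`, and `c` right of `L`. -/
def step (L a b c : ℝ) (x : ℝ) : ℝ :=
  if x < -L then a else if x ≤ L then b else c

/-- The data: `h` on `[-L, L]` and `0` elsewhere. -/
def data (L h : ℝ) : ℝ → ℝ := step L 0 h 0

/-! ### The distributional derivative is unique, so that `variation` is `|Du|(Ω)` -/

lemma measure_le_of_test {Ω : Set ℝ} {A B : Measure ℝ} [IsFiniteMeasure A] [IsFiniteMeasure B]
    (hAB : ∀ φ, IsTestFunction Ω φ → ∫ x, φ x ∂A = ∫ x, φ x ∂B) {V : Set ℝ} (hV : IsOpen V)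
    (hVΩ : V ⊆ Ω) : A V ≤ B V := by
  rw [hV.measure_eq_iSup_isCompact A]
  refine iSup₂_le fun K hKV => iSup_le fun hK => ?_
  obtain ⟨U, hU, hKU, hUV, hUc⟩ := exists_open_between_and_isCompact_closure hK hV hKV
  obtain ⟨f, hfs, hfd, hfr⟩ := hU.exists_contDiff_support_eq (n := ⊤)
  have hf01 : ∀ x, 0 ≤ f x ∧ f x ≤ 1 := fun x => hfr (mem_range_self x)
  let g : ℕ → ℝ → ℝ := fun n x => 1 - (1 - f x) ^ (n + 1)
  have hgz : ∀ n x, x ∉ U → g n x = 0 := by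
    intro n x hx
    have : f x = 0 := by
      rw [← hfs] at hx; simpa using hx
    simp [g, this]
  have hgsupp : ∀ n, tsupport (g n) ⊆ closure U := by
    intro n
    refine closure_mono fun x hx => ?_
    by_contra hxU
    exact hx (hgz n x hxU)
  have hgd : ∀ n, ContDiff ℝ ∞ (g n) := fun n =>
    contDiff_const.sub ((contDiff_const.sub hfd).pow _)
  have hgt : ∀ n, IsTestFunction Ω (g n) := fun n =>
    ⟨hgd n, hUc.of_isClosed_subset (isClosed_tsupport _) (hgsupp n),
      (hgsupp n).trans (hUV.trans hVΩ)⟩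
  have hlim : ∀ x, Tendsto (fun n => g n x) atTop (nhds (U.indicator (fun _ => (1 : ℝ)) x)) := by
    intro x
    by_cases hx : x ∈ U
    · have hpos : 0 < f x := by
        have : f x ≠ 0 := by rw [← hfs] at hx; exact hx
        exact lt_of_le_of_ne (hf01 x).1 this.symm
      have h1 := (tendsto_pow_atTop_nhds_zero_of_lt_one (r := 1 - f x)
        (by linarith [(hf01 x).2]) (by linarith)).comp (tendsto_add_atTop_nat 1)
      simpa [g, hx, Function.comp_def] using h1.const_sub 1
    · simp [hgz _ x hx, hx]
  have hconv : ∀ (C : Measure ℝ) [IsFiniteMeasure C],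
      Tendsto (fun n => ∫ x, g n x ∂C) atTop (nhds (C.real U)) := by
    intro C _
    have := tendsto_integral_of_dominated_convergence (μ := C) (F := g)
      (f := U.indicator (fun _ => (1 : ℝ))) (fun _ => 1)
      (fun n => (hgd n).continuous.aestronglyMeasurable) (integrable_const _)
      (fun n => Eventually.of_forall fun x => by
        have h0 : 0 ≤ 1 - f x := by linarith [(hf01 x).2]
        have h1 : 1 - f x ≤ 1 := by linarith [(hf01 x).1]
        have h2 := pow_nonneg h0 (n + 1)
        have h3 := pow_le_one₀ h0 h1 (n := n + 1)
        rw [Real.norm_eq_abs, abs_le]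
        constructor <;> simp only [g] <;> linarith)
      (Eventually.of_forall hlim)
    rwa [integral_indicator_const _ hU.measurableSet, smul_eq_mul, mul_one] at this
  have hreal : A.real U = B.real U := by
    refine tendsto_nhds_unique (hconv A) ?_
    simpa only [hAB _ (hgt _)] using hconv B
  have hUU : A U = B U := by
    rwa [measureReal_def, measureReal_def,
      ENNReal.toReal_eq_toReal_iff' (measure_ne_top _ _) (measure_ne_top _ _)] at hreal
  calc A K ≤ A U := measure_mono hKU
    _ = B U := hUU
    _ ≤ B V := measure_mono (subset_closure.trans hUV)

lemma restrict_eq_of_test {Ω : Set ℝ} (hΩ : IsOpen Ω) {A B : Measure ℝ} [IsFiniteMeasure A]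
    [IsFiniteMeasure B] (hAB : ∀ φ, IsTestFunction Ω φ → ∫ x, φ x ∂A = ∫ x, φ x ∂B) :
    A.restrict Ω = B.restrict Ω := by
  have key : ∀ V, IsOpen V → A (V ∩ Ω) = B (V ∩ Ω) := fun V hV =>
    le_antisymm (measure_le_of_test hAB (hV.inter hΩ) inter_subset_right)
      (measure_le_of_test (fun φ hφ => (hAB φ hφ).symm) (hV.inter hΩ) inter_subset_right)
  refine ext_of_generate_finite {s | IsOpen s} ?_ isPiSystem_isOpen ?_ ?_
  · exact BorelSpace.measurable_eq
  · intro V (hV : IsOpen V)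
    rw [Measure.restrict_apply hV.measurableSet, Measure.restrict_apply hV.measurableSet]
    exact key V hV
  · rw [Measure.restrict_apply MeasurableSet.univ, Measure.restrict_apply MeasurableSet.univ]
    exact key _ isOpen_univ

lemma totalVariation_unique {Ω : Set ℝ} (hΩ : IsOpen Ω) {u : ℝ → ℝ} {μ ν : SignedMeasure ℝ}
    (hμ : IsDistribDeriv Ω u μ) (hν : IsDistribDeriv Ω u ν) :
    μ.totalVariation Ω = ν.totalVariation Ω := by
  let P := μ.toJordanDecomposition
  let Q := ν.toJordanDecomposition
  let P' : JordanDecomposition ℝ :=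
    ⟨P.posPart.restrict Ω, P.negPart.restrict Ω,
      P.mutuallySingular.mono Measure.restrict_le_self Measure.restrict_le_self⟩
  let Q' : JordanDecomposition ℝ :=
    ⟨Q.posPart.restrict Ω, Q.negPart.restrict Ω,
      Q.mutuallySingular.mono Measure.restrict_le_self Measure.restrict_le_self⟩
  have hsum : (P.posPart + Q.negPart).restrict Ω = (Q.posPart + P.negPart).restrict Ω := by
    refine restrict_eq_of_test hΩ fun φ hφ => ?_
    have hi : ∀ (C : Measure ℝ) [IsFiniteMeasure C], Integrable φ C := fun C _ =>
      hφ.1.continuous.integrable_of_hasCompactSupport hφ.2.1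
    rw [integral_add_measure (hi _) (hi _), integral_add_measure (hi _) (hi _)]
    have h := (hμ φ hφ).symm.trans (hν φ hφ)
    simp only [signedIntegral] at h
    change ∫ x, φ x ∂μ.toJordanDecomposition.posPart + ∫ x, φ x ∂ν.toJordanDecomposition.negPart =
      ∫ x, φ x ∂ν.toJordanDecomposition.posPart + ∫ x, φ x ∂μ.toJordanDecomposition.negPart
    linarith
  have hPQ : P' = Q' := by
    apply JordanDecomposition.toSignedMeasure_injective
    ext s hs
    have h := congrArg (fun C : Measure ℝ => C.real s) hsum
    rw [Measure.restrict_add, Measure.restrict_add] at h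
    rw [measureReal_add_apply, measureReal_add_apply] at h
    simp only [JordanDecomposition.toSignedMeasure, Measure.toSignedMeasure_sub_apply hs, P', Q']
    linarith
  have e1 : P.posPart.restrict Ω = Q.posPart.restrict Ω :=
    congrArg JordanDecomposition.posPart hPQ
  have e2 : P.negPart.restrict Ω = Q.negPart.restrict Ω :=
    congrArg JordanDecomposition.negPart hPQ
  have e1' := congrArg (fun C : Measure ℝ => C univ) e1
  have e2' := congrArg (fun C : Measure ℝ => C univ) e2
  simp only [Measure.restrict_apply MeasurableSet.univ, univ_inter] at e1' e2'
  change P.posPart Ω + P.negPart Ω = Q.posPart Ω + Q.negPart Ω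
  rw [e1', e2']

/-- If the measure `μ` is the distributional derivative of `u` on the open set `Ω`, then
`variation Ω u` is the total variation of `μ` on `Ω`. -/
theorem variation_eq {Ω : Set ℝ} (hΩ : IsOpen Ω) {u : ℝ → ℝ} {μ : SignedMeasure ℝ}
    (hμ : IsDistribDeriv Ω u μ) : variation Ω u = μ.totalVariation Ω :=
  le_antisymm (iInf₂_le μ hμ)
    (le_iInf₂ fun _ hν => (totalVariation_unique hΩ hμ hν).le)

end TVIC

end

/-!
All four regimes are settled by one convex duality argument. The fidelity term dominates the
integral of the Huber function `huber` of `f - u` (`lintegral_huber_le_fidelity`). Fix a point `σ` of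
the quadratic part of the Huber function. Its tangent lines at `σ` and `-σ`, used on `[-L, L]` and
elsewhere, have slopes `l₂ * σ` and `-(l₂ * σ)`, and bound the fidelity from below by an affine
function of `u`, whose linear part is `-(l₂ * σ)` times the integral of `u` over `[-L, L]` minus the
integral over the outer part, the `contrast` of `u` (`integral_huber_bound`). The contrast is in turn
at most `L * |Du|(Ω)` (`contrast_le_of_ae_eq`), so for `l₂ * σ * L ≤ 1` the energy is at least the
number `minEnergy` (`energy_bound`). In other words, the dual certificate is the piecewise affine
function with derivative `±(l₂ * σ)` that vanishes at `-2L`, `0`, `2L`, and whose peaks at `±L` have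
height `l₂ * σ * L`.

The bound on the contrast comes from writing `u`, almost everywhere, as a constant plus a difference
of two bounded monotone functions, the distribution functions of the positive and negative part of
`Du` (`IsDistribDeriv.ae_eq_leftMass`). For a monotone function with values in `[0, p]`, the difference
between `L * p` and the contrast is a sum of three nonnegative integrals; it vanishes only if the
function jumps from `0` to `p` at `-L` (`eq_of_monotone_of_contrast_eq`). Hence equality in the lower
bound forces a step function, jumping up at `-L` and down at `L`. Equality in the tangent bounds
restricts its levels as in `Optimal`, and step functions with such levels do attain the lower bound
(`energy_le_of_optimal`). So the solutions are exactly the step functions with optimal levels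
(`mem_solutions_iff`), as soon as there are any. The choice of `σ` is `h / 2` if this keeps the slope
below the maximal slope `l₁` of the Huber function and the peaks of the certificate at most `1`; it is
`l₁ / l₂` if the slope can be `l₁` itself; and it is `1 / (L * l₂)` if the peaks reach `1` at a slope
below `l₁`.
-/

noncomputable section

namespace TVIC

/-! ### Functions of bounded variation on an interval -/

lemma IsTestFunction.integrable_deriv {Ω : Set ℝ} {φ : ℝ → ℝ} (hφ : IsTestFunction Ω φ) :
    Integrable (deriv φ) :=
  (hφ.1.continuous_deriv (by simp)).integrable_of_hasCompactSupport hφ.2.1.deriv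

lemma IsTestFunction.eq_zero {Ω : Set ℝ} {φ : ℝ → ℝ} (hφ : IsTestFunction Ω φ) {x : ℝ}
    (hx : x ∉ Ω) : φ x = 0 :=
  image_eq_zero_of_notMem_tsupport fun h => hx (hφ.2.2 h)

lemma IsTestFunction.deriv_eq_zero {Ω : Set ℝ} {φ : ℝ → ℝ} (hφ : IsTestFunction Ω φ) {x : ℝ}
    (hx : x ∉ Ω) : deriv φ x = 0 := by
  by_contra h
  exact hx (hφ.2.2 (support_deriv_subset h))

lemma IsTestFunction.setIntegral_deriv {Ω : Set ℝ} {φ : ℝ → ℝ} (hφ : IsTestFunction Ω φ) :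
    ∫ x in Ω, deriv φ x = 0 := by
  rw [setIntegral_eq_integral_of_forall_compl_eq_zero fun x hx => hφ.deriv_eq_zero hx]
  exact integral_eq_zero_of_hasDerivAt_of_integrable
    (fun x => (hφ.1.differentiable (by simp) x).hasDerivAt) hφ.integrable_deriv
    (hφ.1.continuous.integrable_of_hasCompactSupport hφ.2.1)

/-- A test function with zero integral on an interval has a primitive that is a test function. -/
lemma IsTestFunction.exists_primitive {a b : ℝ} {ψ : ℝ → ℝ} (hψ : IsTestFunction (Ioo a b) ψ)
    (h0 : ∫ x, ψ x = 0) : ∃ φ, IsTestFunction (Ioo a b) φ ∧ deriv φ = ψ := by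
  rcases (tsupport ψ).eq_empty_or_nonempty with he | hne
  · have hz : ψ = 0 := tsupport_eq_empty_iff.1 he
    refine ⟨0, ⟨contDiff_const, HasCompactSupport.zero, by simp [tsupport]⟩, ?_⟩
    simp [hz]
  obtain ⟨p, hp, hpl⟩ := hψ.2.1.exists_isLeast hne
  obtain ⟨q, hq, hql⟩ := hψ.2.1.exists_isGreatest hne
  have hsub : Icc p q ⊆ Ioo a b := fun x hx =>
    ⟨(hψ.2.2 hp).1.trans_le hx.1, hx.2.trans_lt (hψ.2.2 hq).2⟩
  have hz : ∀ x, x ∉ Icc p q → ψ x = 0 := fun x hx =>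
    image_eq_zero_of_notMem_tsupport fun h => hx ⟨hpl h, hql h⟩
  have hc : Continuous ψ := hψ.1.continuous
  have hi : Integrable ψ := hc.integrable_of_hasCompactSupport hψ.2.1
  let φ : ℝ → ℝ := fun x => ∫ t in a..x, ψ t
  have hd : ∀ x, HasDerivAt φ (ψ x) x := fun x =>
    intervalIntegral.integral_hasDerivAt_right (hc.intervalIntegrable _ _)
      (hc.stronglyMeasurableAtFilter _ _) hc.continuousAt
  have hdφ : deriv φ = ψ := funext fun x => (hd x).deriv
  have hap : a < p := (hψ.2.2 hp).1
  have hφz : ∀ x, x ∉ Icc p q → φ x = 0 := by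
    intro x hx
    rcases lt_or_ge x p with hxp | hxp
    · refine intervalIntegral.integral_zero_ae (Eventually.of_forall fun t ht => hz t fun ht' => ?_)
      rw [uIoc, mem_Ioc] at ht
      have : max a x < p := max_lt hap hxp
      linarith [ht.2, ht'.1]
    · have hxq : q < x := by
        by_contra hcon
        exact hx ⟨hxp, not_lt.1 hcon⟩
      change ∫ t in a..x, ψ t = 0
      rw [intervalIntegral.integral_of_le (by linarith),
        setIntegral_eq_integral_of_forall_compl_eq_zero, h0]
      intro t ht
      exact hz t fun ht' => ht ⟨hap.trans_le ht'.1, ht'.2.trans hxq.le⟩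
  have hts : tsupport φ ⊆ Icc p q := by
    refine closure_minimal (fun x hx => ?_) isClosed_Icc
    by_contra hcon
    exact hx (hφz x hcon)
  refine ⟨φ, ⟨contDiff_infty_iff_deriv.2 ⟨fun x => (hd x).differentiableAt, ?_⟩,
    isCompact_Icc.of_isClosed_subset (isClosed_tsupport _) hts, hts.trans hsub⟩, hdφ⟩
  rw [hdφ]
  exact hψ.1

/-- The lemma of du Bois-Reymond. -/
lemma ae_eq_const_of_integral_mul_deriv_eq_zero {a b : ℝ} (hab : a < b) {g : ℝ → ℝ}
    (hg : IntegrableOn g (Ioo a b))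
    (h : ∀ φ, IsTestFunction (Ioo a b) φ → ∫ x in Ioo a b, g x * deriv φ x = 0) :
    ∃ c : ℝ, g =ᵐ[volume.restrict (Ioo a b)] fun _ => c := by
  obtain ⟨θ, hθ, hθ1⟩ : ∃ θ, IsTestFunction (Ioo a b) θ ∧ ∫ x, θ x = 1 := by
    let β : ContDiffBump ((a + b) / 2) := ⟨(b - a) / 8, (b - a) / 4, by linarith, by linarith⟩
    refine ⟨β.normed volume, ⟨β.contDiff_normed, β.hasCompactSupport_normed, ?_⟩,
      β.integral_normed⟩
    rw [β.tsupport_normed_eq, Real.closedBall_eq_Icc]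
    intro x hx
    have h1 := hx.1
    have h2 := hx.2
    simp only [β] at h1 h2
    constructor <;> linarith
  have hint : ∀ ψ, IsTestFunction (Ioo a b) ψ → IntegrableOn (fun x => g x * ψ x) (Ioo a b) := by
    intro ψ hψ
    obtain ⟨C, hC⟩ := hψ.1.continuous.bounded_above_of_compact_support hψ.2.1
    exact hg.mul_bdd hψ.1.continuous.aestronglyMeasurable (Eventually.of_forall hC)
  have hi : ∀ ψ, IsTestFunction (Ioo a b) ψ → Integrable ψ := fun ψ hψ =>
    hψ.1.continuous.integrable_of_hasCompactSupport hψ.2.1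
  set c : ℝ := ∫ x in Ioo a b, g x * θ x with hc
  refine ⟨c, ?_⟩
  have key : ∀ᵐ x, x ∈ Ioo a b → g x - c = 0 := by
    refine isOpen_Ioo.ae_eq_zero_of_integral_contDiff_smul_eq_zero
      (hg.sub (by simp)).locallyIntegrableOn ?_
    intro ψ h1 h2 h3
    have hψ : IsTestFunction (Ioo a b) ψ := ⟨h1, h2, h3⟩
    set I : ℝ := ∫ x, ψ x with hI
    have ht : IsTestFunction (Ioo a b) (fun x => ψ x - I * θ x) := by
      refine ⟨h1.sub (contDiff_const.mul hθ.1), h2.sub hθ.2.1.mul_left, ?_⟩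
      refine (tsupport_sub _ _).trans (union_subset h3 ?_)
      exact (tsupport_mul_subset_right (f := fun _ => I)).trans hθ.2.2
    obtain ⟨φ, hφ, hdφ⟩ := ht.exists_primitive (by
      rw [integral_sub (hi ψ hψ) ((hi θ hθ).const_mul _), integral_const_mul, hθ1]
      simp [hI])
    have h4 := h φ hφ
    rw [hdφ] at h4
    have h5 : ∫ x in Ioo a b, g x * (ψ x - I * θ x)
        = (∫ x in Ioo a b, g x * ψ x) - I * c := by
      rw [hc, ← integral_const_mul, ← integral_sub (hint ψ hψ) ((hint θ hθ).const_mul _)]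
      congr 1 with x
      ring
    rw [← setIntegral_eq_integral_of_forall_compl_eq_zero (s := Ioo a b)
      (fun x hx => by simp [hψ.eq_zero hx])]
    have h6 : ∫ x in Ioo a b, ψ x • (g x - c) = (∫ x in Ioo a b, g x * ψ x) - c * I := by
      rw [hI, ← setIntegral_eq_integral_of_forall_compl_eq_zero (s := Ioo a b)
        (fun x hx => hψ.eq_zero hx), ← integral_const_mul,
        ← integral_sub (hint ψ hψ) ((hi ψ hψ).integrableOn.const_mul _)]
      congr 1 with x
      simp only [smul_eq_mul]
      ring
    rw [h6]
    linarith
  refine (ae_restrict_iff' measurableSet_Ioo).2 ?_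
  filter_upwards [key] with x hx hxm
  linarith [hx hxm]

/-- The mass that `A` gives to the part of `Ω` left of `x`, `x` included: the monotone function on
`Ω` whose distributional derivative is `A`. -/
def leftMass (Ω : Set ℝ) (A : Measure ℝ) (x : ℝ) : ℝ := (A.restrict Ω).real (Iic x)

lemma leftMass_monotone (Ω : Set ℝ) (A : Measure ℝ) [IsFiniteMeasure A] :
    Monotone (leftMass Ω A) := fun _ _ h => measureReal_mono (Iic_subset_Iic.2 h)

lemma leftMass_nonneg (Ω : Set ℝ) (A : Measure ℝ) (x : ℝ) : 0 ≤ leftMass Ω A x :=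
  measureReal_nonneg

lemma leftMass_le (Ω : Set ℝ) (A : Measure ℝ) [IsFiniteMeasure A] (x : ℝ) :
    leftMass Ω A x ≤ A.real Ω := by
  refine (measureReal_mono (subset_univ _)).trans_eq ?_
  simp [measureReal_def]

lemma integral_leftMass_mul_deriv {Ω : Set ℝ} (A : Measure ℝ) [IsFiniteMeasure A]
    {φ : ℝ → ℝ} (hφ : IsTestFunction Ω φ) :
    ∫ x in Ω, leftMass Ω A x * deriv φ x = -∫ x, φ x ∂A := by
  rw [setIntegral_eq_integral_of_forall_compl_eq_zero
    (fun x hx => by rw [hφ.deriv_eq_zero hx, mul_zero]),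
    ← setIntegral_eq_integral_of_forall_compl_eq_zero (μ := A) (fun x hx => hφ.eq_zero hx)]
  have hset : MeasurableSet {p : ℝ × ℝ | p.2 ≤ p.1} := measurableSet_le measurable_snd measurable_fst
  have hint : Integrable (fun p : ℝ × ℝ => {p : ℝ × ℝ | p.2 ≤ p.1}.indicator
      (fun p => deriv φ p.1) p) (volume.prod (A.restrict Ω)) :=
    (hφ.integrable_deriv.comp_fst _).indicator hset
  have h1 : ∀ x, leftMass Ω A x * deriv φ x = ∫ t, {p : ℝ × ℝ | p.2 ≤ p.1}.indicator
      (fun p => deriv φ p.1) (x, t) ∂(A.restrict Ω) := by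
    intro x
    have : (fun t => {p : ℝ × ℝ | p.2 ≤ p.1}.indicator (fun p => deriv φ p.1) (x, t))
        = (Iic x).indicator fun _ => deriv φ x := by
      ext t
      by_cases ht : t ≤ x <;> simp [ht]
    rw [this, integral_indicator_const _ measurableSet_Iic]
    rfl
  simp_rw [h1]
  rw [integral_integral_swap hint, ← integral_neg]
  congr 1 with t
  have : (fun x => {p : ℝ × ℝ | p.2 ≤ p.1}.indicator (fun p => deriv φ p.1) (x, t))
      = (Ici t).indicator (deriv φ) := by
    ext x
    by_cases ht : t ≤ x <;> simp [ht]
  rw [this, integral_indicator measurableSet_Ici, integral_Ici_eq_integral_Ioi]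
  exact hφ.2.1.integral_Ioi_deriv_eq (hφ.1.of_le (by simp)) t

lemma integrableOn_leftMass_mul {Ω : Set ℝ} (A : Measure ℝ) [IsFiniteMeasure A] {ψ : ℝ → ℝ}
    (hψ : Integrable ψ) : IntegrableOn (fun x => leftMass Ω A x * ψ x) Ω := by
  refine hψ.integrableOn.bdd_mul (c := A.real Ω)
    (leftMass_monotone Ω A).measurable.aestronglyMeasurable (Eventually.of_forall fun x => ?_)
  rw [Real.norm_of_nonneg (leftMass_nonneg Ω A x)]
  exact leftMass_le Ω A x

lemma isDistribDeriv_leftMass {Ω : Set ℝ} (c : ℝ) (μ : SignedMeasure ℝ) :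
    IsDistribDeriv Ω (fun x => c + leftMass Ω μ.toJordanDecomposition.posPart x
      - leftMass Ω μ.toJordanDecomposition.negPart x) μ := by
  intro φ hφ
  have hd := hφ.integrable_deriv
  have h : ∀ x, (c + leftMass Ω μ.toJordanDecomposition.posPart x
      - leftMass Ω μ.toJordanDecomposition.negPart x) * deriv φ x
      = (c * deriv φ x + leftMass Ω μ.toJordanDecomposition.posPart x * deriv φ x)
      - leftMass Ω μ.toJordanDecomposition.negPart x * deriv φ x := fun x => by ring
  have hA : IntegrableOn (fun x => c * deriv φ x
      + leftMass Ω μ.toJordanDecomposition.posPart x * deriv φ x) Ω :=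
    (hd.const_mul c).integrableOn.add (integrableOn_leftMass_mul _ hd)
  simp_rw [h]
  rw [integral_sub hA (integrableOn_leftMass_mul _ hd),
    integral_add (hd.const_mul c).integrableOn (integrableOn_leftMass_mul _ hd),
    integral_const_mul, hφ.setIntegral_deriv, integral_leftMass_mul_deriv _ hφ,
    integral_leftMass_mul_deriv _ hφ, signedIntegral]
  ring

lemma IsDistribDeriv.congr_ae {Ω : Set ℝ} {u w : ℝ → ℝ} {μ : SignedMeasure ℝ}
    (h : IsDistribDeriv Ω u μ) (huw : u =ᵐ[volume.restrict Ω] w) : IsDistribDeriv Ω w μ := by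
  intro φ hφ
  rw [← h φ hφ]
  refine integral_congr_ae ?_
  filter_upwards [huw] with x hx
  rw [hx]

/-- A function on an interval whose distributional derivative is a finite measure is a difference
of two bounded monotone functions, up to a constant and a null set. -/
lemma IsDistribDeriv.ae_eq_leftMass {a b : ℝ} (hab : a < b) {u : ℝ → ℝ}
    (hu : IntegrableOn u (Ioo a b)) {μ : SignedMeasure ℝ} (h : IsDistribDeriv (Ioo a b) u μ) :
    ∃ c : ℝ, u =ᵐ[volume.restrict (Ioo a b)] fun x =>
      c + leftMass (Ioo a b) μ.toJordanDecomposition.posPart x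
        - leftMass (Ioo a b) μ.toJordanDecomposition.negPart x := by
  set G : ℝ → ℝ := fun x => 0 + leftMass (Ioo a b) μ.toJordanDecomposition.posPart x
    - leftMass (Ioo a b) μ.toJordanDecomposition.negPart x with hG
  have hGm : Measurable G :=
    (measurable_const.add (leftMass_monotone _ _).measurable).sub (leftMass_monotone _ _).measurable
  have hGb : ∀ x, ‖G x‖ ≤ μ.toJordanDecomposition.posPart.real (Ioo a b)
      + μ.toJordanDecomposition.negPart.real (Ioo a b) := by
    intro x
    have h1 := leftMass_nonneg (Ioo a b) μ.toJordanDecomposition.posPart x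
    have h2 := leftMass_nonneg (Ioo a b) μ.toJordanDecomposition.negPart x
    have h3 := leftMass_le (Ioo a b) μ.toJordanDecomposition.posPart x
    have h4 := leftMass_le (Ioo a b) μ.toJordanDecomposition.negPart x
    rw [Real.norm_eq_abs, abs_le]
    constructor <;> simp only [hG] <;> linarith
  have hGi : IntegrableOn G (Ioo a b) :=
    Integrable.of_bound hGm.aestronglyMeasurable _ (Eventually.of_forall hGb)
  obtain ⟨c, hc⟩ := ae_eq_const_of_integral_mul_deriv_eq_zero hab (hu.sub hGi) (by
    intro φ hφ
    obtain ⟨C, hC⟩ := (hφ.1.continuous_deriv (by simp)).bounded_above_of_compact_support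
      hφ.2.1.deriv
    have hm : AEStronglyMeasurable (deriv φ) (volume.restrict (Ioo a b)) :=
      (hφ.1.continuous_deriv (by simp)).aestronglyMeasurable
    simp_rw [Pi.sub_apply, sub_mul]
    rw [integral_sub (hu.mul_bdd hm (Eventually.of_forall hC))
      (hGi.mul_bdd hm (Eventually.of_forall hC)), h φ hφ, isDistribDeriv_leftMass 0 μ φ hφ, sub_self])
  refine ⟨c, ?_⟩
  filter_upwards [hc] with x hx
  simp only [Pi.sub_apply, hG] at hx
  linarith

/-! ### Step functions and the contrast between the middle and the outer part -/

lemma measurable_step (L a b c : ℝ) : Measurable (step L a b c) :=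
  Measurable.ite measurableSet_Iio measurable_const
    (Measurable.ite measurableSet_Iic measurable_const measurable_const)

lemma abs_step_le (L a b c x : ℝ) : |step L a b c x| ≤ |a| + |b| + |c| := by
  have ha := abs_nonneg a
  have hb := abs_nonneg b
  have hc := abs_nonneg c
  unfold step
  split_ifs <;> linarith

lemma isOpen_dom (L : ℝ) : IsOpen (dom L) := isOpen_Ioo

lemma setIntegral_dom_eq {L : ℝ} (hL : 0 < L) (w : ℝ → ℝ) :
    ∫ x in dom L, w x = ∫ x in (-2 * L)..(2 * L), w x := by
  rw [intervalIntegral.integral_of_le (by linarith), integral_Ioc_eq_integral_Ioo, dom]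

lemma intervalIntegrable_of_dom {L : ℝ} {w : ℝ → ℝ} (hw : IntegrableOn w (dom L))
    {a b : ℝ} (ha : -2 * L ≤ a) (hab : a ≤ b) (hb : b ≤ 2 * L) : IntervalIntegrable w volume a b :=
  (intervalIntegrable_iff_integrableOn_Ioo_of_le hab).2
    (hw.mono_set (Ioo_subset_Ioo ha hb))

lemma integrableOn_step_mul {L : ℝ} (a b c : ℝ) {w : ℝ → ℝ}
    (hw : IntegrableOn w (dom L)) : IntegrableOn (fun x => step L a b c x * w x) (dom L) :=
  hw.bdd_mul (measurable_step L a b c).aestronglyMeasurable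
    (Eventually.of_forall (abs_step_le L a b c))

lemma setIntegral_step_mul {L : ℝ} (hL : 0 < L) (a b c : ℝ) {w : ℝ → ℝ}
    (hw : IntegrableOn w (dom L)) :
    ∫ x in dom L, step L a b c x * w x = a * (∫ x in (-2 * L)..(-L), w x)
      + b * (∫ x in (-L)..L, w x) + c * ∫ x in L..(2 * L), w x := by
  have hi := integrableOn_step_mul a b c hw
  rw [setIntegral_dom_eq hL, ← intervalIntegral.integral_add_adjacent_intervals (b := -L)
      (intervalIntegrable_of_dom hi le_rfl (by linarith) (by linarith))
      (intervalIntegrable_of_dom hi (by linarith) (by linarith) le_rfl),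
    ← intervalIntegral.integral_add_adjacent_intervals (a := -L) (b := L)
      (intervalIntegrable_of_dom hi (by linarith) (by linarith) (by linarith))
      (intervalIntegrable_of_dom hi (by linarith) (by linarith) le_rfl)]
  rw [← intervalIntegral.integral_const_mul, ← intervalIntegral.integral_const_mul,
    ← intervalIntegral.integral_const_mul, add_assoc]
  congr 1
  · rw [intervalIntegral.integral_of_le (by linarith), intervalIntegral.integral_of_le (by linarith),
      integral_Ioc_eq_integral_Ioo, integral_Ioc_eq_integral_Ioo]
    refine setIntegral_congr_fun measurableSet_Ioo fun x hx => ?_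
    simp [step, hx.2]
  congr 1
  · rw [intervalIntegral.integral_of_le (by linarith), intervalIntegral.integral_of_le (by linarith)]
    refine setIntegral_congr_fun measurableSet_Ioc fun x hx => ?_
    simp [step, hx.1.le, hx.2]
  · rw [intervalIntegral.integral_of_le (by linarith), intervalIntegral.integral_of_le (by linarith)]
    refine setIntegral_congr_fun measurableSet_Ioc fun x hx => ?_
    have h1 : ¬ x < -L := by linarith [hx.1]
    have h2 : ¬ x ≤ L := not_le.2 hx.1
    simp [step, h1, h2]

lemma integrableOn_const_dom (L c : ℝ) : IntegrableOn (fun _ => c) (dom L) := by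
  simp [dom]

lemma integrableOn_step (L a b c : ℝ) : IntegrableOn (step L a b c) (dom L) := by
  simpa using integrableOn_step_mul a b c (integrableOn_const_dom L 1)

lemma setIntegral_step {L : ℝ} (hL : 0 < L) (a b c : ℝ) :
    ∫ x in dom L, step L a b c x = L * (a + 2 * b + c) := by
  have h := setIntegral_step_mul hL a b c (integrableOn_const_dom L 1)
  simp only [mul_one, intervalIntegral.integral_const, smul_eq_mul] at h
  rw [h]
  ring

/-- The sign `1` on `[-L, L]` and `-1` elsewhere: where a solution lies below and above the
data, respectively. -/
def sign (L : ℝ) : ℝ → ℝ := step L (-1) 1 (-1)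

/-- The integral of `w` over the middle part `[-L, L]`, minus the integral over the outer part. -/
def contrast (L : ℝ) (w : ℝ → ℝ) : ℝ := ∫ x in dom L, sign L x * w x

lemma contrast_eq {L : ℝ} (hL : 0 < L) {w : ℝ → ℝ} (hw : IntegrableOn w (dom L)) :
    contrast L w = (∫ x in (-L)..L, w x) - (∫ x in (-2 * L)..(-L), w x)
      - ∫ x in L..(2 * L), w x := by
  rw [contrast, sign, setIntegral_step_mul hL _ _ _ hw]
  ring

lemma contrast_congr {L : ℝ} {w w' : ℝ → ℝ} (h : w =ᵐ[volume.restrict (dom L)] w') :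
    contrast L w = contrast L w' := by
  refine integral_congr_ae ?_
  filter_upwards [h] with x hx
  rw [hx]

/-- A nonnegative monotone function with zero integral vanishes. -/
lemma eq_zero_of_monotone_of_integral_eq_zero {P : ℝ → ℝ} (hP : Monotone P) (h0 : ∀ x, 0 ≤ P x)
    {a b x : ℝ} (hax : a ≤ x) (hxb : x < b) (hint : ∫ t in a..b, P t = 0) : P x = 0 := by
  have h1 := intervalIntegral.integral_add_adjacent_intervals (μ := volume)
    (hP.intervalIntegrable (a := a) (b := x)) (hP.intervalIntegrable (a := x) (b := b))
  have h2 : 0 ≤ ∫ t in a..x, P t := intervalIntegral.integral_nonneg hax fun t _ => h0 t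
  have h3 : ∫ t in x..b, P x ≤ ∫ t in x..b, P t :=
    intervalIntegral.integral_mono_on hxb.le (by simp) hP.intervalIntegrable
      fun t ht => hP ht.1
  rw [intervalIntegral.integral_const, smul_eq_mul] at h3
  have h4 := h0 x
  nlinarith

lemma integrableOn_dom_of_monotone {P : ℝ → ℝ} (hP : Monotone P) {L : ℝ} (hL : 0 < L) :
    IntegrableOn P (dom L) :=
  (intervalIntegrable_iff_integrableOn_Ioo_of_le (by linarith)).1
    (hP.intervalIntegrable (a := -2 * L) (b := 2 * L))

/-- The contrast of a monotone function with values in `[0, p]` is at most `L * p`. The deficit is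
a sum of three nonnegative integrals. -/
lemma mul_sub_contrast_eq {L : ℝ} (hL : 0 < L) {P : ℝ → ℝ} (hP : Monotone P) (p : ℝ) :
    L * p - contrast L P = (∫ x in (-2 * L)..(-L), P x) + (∫ x in 0..L, (p - P (-x)))
      + ∫ x in 0..L, (P (x + L) - P x) := by
  have hi : ∀ a b, IntervalIntegrable P volume a b := fun a b => hP.intervalIntegrable
  have hr : IntervalIntegrable (fun x => P (-x)) volume 0 L :=
    Antitone.intervalIntegrable fun x y hxy => hP (neg_le_neg hxy)
  have hs : IntervalIntegrable (fun x => P (x + L)) volume 0 L :=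
    Monotone.intervalIntegrable fun x y hxy => hP (by linarith)
  rw [contrast_eq hL (integrableOn_dom_of_monotone hP hL), intervalIntegral.integral_sub (by simp) hr,
    intervalIntegral.integral_sub hs (hi _ _), intervalIntegral.integral_comp_neg,
    intervalIntegral.integral_comp_add_right,
    ← intervalIntegral.integral_add_adjacent_intervals (hi (-L) 0) (hi 0 L),
    intervalIntegral.integral_const, smul_eq_mul, neg_zero, zero_add, ← two_mul]
  ring

lemma contrast_le_of_monotone {L : ℝ} (hL : 0 < L) {P : ℝ → ℝ} (hP : Monotone P) {p : ℝ}
    (h0 : ∀ x, 0 ≤ P x) (hp : ∀ x, P x ≤ p) : contrast L P ≤ L * p := by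
  have h := mul_sub_contrast_eq hL hP p
  have h1 : 0 ≤ ∫ x in (-2 * L)..(-L), P x :=
    intervalIntegral.integral_nonneg (by linarith) fun x _ => h0 x
  have h2 : 0 ≤ ∫ x in 0..L, (p - P (-x)) :=
    intervalIntegral.integral_nonneg hL.le fun x _ => sub_nonneg.2 (hp _)
  have h3 : 0 ≤ ∫ x in 0..L, (P (x + L) - P x) :=
    intervalIntegral.integral_nonneg hL.le fun x _ => sub_nonneg.2 (hP (by linarith))
  linarith

lemma eq_of_monotone_of_contrast_eq {L : ℝ} (hL : 0 < L) {P : ℝ → ℝ} (hP : Monotone P) {p : ℝ}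
    (h0 : ∀ x, 0 ≤ P x) (hp : ∀ x, P x ≤ p) (heq : contrast L P = L * p) :
    (∀ x, -2 * L ≤ x → x < -L → P x = 0) ∧ ∀ x, -L < x → P x = p := by
  have h := mul_sub_contrast_eq hL hP p
  have h1 : 0 ≤ ∫ x in (-2 * L)..(-L), P x :=
    intervalIntegral.integral_nonneg (by linarith) fun x _ => h0 x
  have h2 : 0 ≤ ∫ x in 0..L, (p - P (-x)) :=
    intervalIntegral.integral_nonneg hL.le fun x _ => sub_nonneg.2 (hp _)
  have h3 : 0 ≤ ∫ x in 0..L, (P (x + L) - P x) :=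
    intervalIntegral.integral_nonneg hL.le fun x _ => sub_nonneg.2 (hP (by linarith))
  refine ⟨fun x hx1 hx2 => eq_zero_of_monotone_of_integral_eq_zero hP h0 hx1 hx2 (by linarith),
    fun x hx => ?_⟩
  have hQ : Monotone fun x => p - P (-x) := fun x y hxy => by
    have := hP (neg_le_neg hxy)
    simp only
    linarith
  have h4 := eq_zero_of_monotone_of_integral_eq_zero hQ (fun x => sub_nonneg.2 (hp _))
    (x := max 0 (-x)) (a := 0) (b := L) (le_max_left _ _) (max_lt hL (by linarith)) (by linarith)
  have h5 : P (-max 0 (-x)) ≤ P x := hP (by linarith [le_max_right 0 (-x)])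
  linarith [hp x]

/-- The reflection `n - N (-x)` of a monotone function has the opposite contrast. -/
lemma contrast_reflect {L : ℝ} (hL : 0 < L) {N : ℝ → ℝ} (hN : Monotone N) (n : ℝ) :
    contrast L (fun x => n - N (-x)) = -contrast L N := by
  have hQ : Monotone fun x => n - N (-x) := fun x y hxy => by
    have := hN (neg_le_neg hxy)
    simp only
    linarith
  have hr : ∀ a b, IntervalIntegrable (fun x => N (-x)) volume a b := fun a b =>
    Antitone.intervalIntegrable fun x y hxy => hN (neg_le_neg hxy)
  rw [contrast_eq hL (integrableOn_dom_of_monotone hQ hL),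
    contrast_eq hL (integrableOn_dom_of_monotone hN hL)]
  simp only [intervalIntegral.integral_sub intervalIntegrable_const (hr _ _),
    intervalIntegral.integral_comp_neg, intervalIntegral.integral_const, smul_eq_mul, neg_neg,
    neg_mul]
  ring

lemma contrast_eq_of_ae_eq {L : ℝ} (hL : 0 < L) {w P N : ℝ → ℝ} {c : ℝ}
    (hw : w =ᵐ[volume.restrict (dom L)] fun x => c + P x - N x) (hP : Monotone P)
    (hN : Monotone N) : contrast L w = contrast L P - contrast L N := by
  have hc : ∫ x in dom L, sign L x * c = 0 := by
    rw [sign, setIntegral_step_mul hL _ _ _ (integrableOn_const_dom L c)]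
    simp only [intervalIntegral.integral_const, smul_eq_mul]
    ring
  have e : ∀ x, sign L x * (c + P x - N x) = (sign L x * c + sign L x * P x) - sign L x * N x :=
    fun x => by ring
  have i1 : IntegrableOn (fun x => sign L x * c) (dom L) :=
    integrableOn_step_mul _ _ _ (integrableOn_const_dom L c)
  have i2 : IntegrableOn (fun x => sign L x * P x) (dom L) :=
    integrableOn_step_mul _ _ _ (integrableOn_dom_of_monotone hP hL)
  have i3 : IntegrableOn (fun x => sign L x * N x) (dom L) :=
    integrableOn_step_mul _ _ _ (integrableOn_dom_of_monotone hN hL)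
  have i4 : IntegrableOn (fun x => sign L x * c + sign L x * P x) (dom L) := i1.add i2
  rw [contrast_congr hw, contrast]
  simp_rw [e]
  rw [integral_sub i4 i3, integral_add i1 i2, hc, zero_add]
  rfl

lemma contrast_le_of_ae_eq {L : ℝ} (hL : 0 < L) {w P N : ℝ → ℝ} {c p n : ℝ}
    (hw : w =ᵐ[volume.restrict (dom L)] fun x => c + P x - N x)
    (hP : Monotone P) (hP0 : ∀ x, 0 ≤ P x) (hPp : ∀ x, P x ≤ p)
    (hN : Monotone N) (hN0 : ∀ x, 0 ≤ N x) (hNn : ∀ x, N x ≤ n) :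
    contrast L w ≤ L * (p + n) := by
  have hQ : Monotone fun x => n - N (-x) := fun x y hxy => by
    have := hN (neg_le_neg hxy)
    simp only
    linarith
  have h1 := contrast_le_of_monotone hL hP hP0 hPp
  have h2 := contrast_le_of_monotone hL (p := n) hQ (fun x => sub_nonneg.2 (hNn _))
    (fun x => by linarith [hN0 (-x)])
  rw [contrast_reflect hL hN] at h2
  rw [contrast_eq_of_ae_eq hL hw hP hN]
  linarith

/-- A function whose contrast is `L` times its variation can only jump upwards at `-L` and
downwards at `L`. -/
lemma ae_eq_step_of_contrast_eq {L : ℝ} (hL : 0 < L) {w P N : ℝ → ℝ} {c p n : ℝ}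
    (hw : w =ᵐ[volume.restrict (dom L)] fun x => c + P x - N x)
    (hP : Monotone P) (hP0 : ∀ x, 0 ≤ P x) (hPp : ∀ x, P x ≤ p)
    (hN : Monotone N) (hN0 : ∀ x, 0 ≤ N x) (hNn : ∀ x, N x ≤ n)
    (heq : contrast L w = L * (p + n)) :
    w =ᵐ[volume.restrict (dom L)] step L c (c + p) (c + p - n) := by
  have hQ : Monotone fun x => n - N (-x) := fun x y hxy => by
    have := hN (neg_le_neg hxy)
    simp only
    linarith
  have hQ0 : ∀ x, 0 ≤ n - N (-x) := fun x => sub_nonneg.2 (hNn _)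
  have hQn : ∀ x, n - N (-x) ≤ n := fun x => by linarith [hN0 (-x)]
  have h1 := contrast_le_of_monotone hL hP hP0 hPp
  have h2 := contrast_le_of_monotone hL (p := n) hQ hQ0 hQn
  have h3 := contrast_reflect hL hN n
  rw [contrast_eq_of_ae_eq hL hw hP hN] at heq
  obtain ⟨hPl, hPr⟩ := eq_of_monotone_of_contrast_eq hL hP hP0 hPp (by linarith)
  obtain ⟨hQl, hQr⟩ := eq_of_monotone_of_contrast_eq hL (p := n) hQ hQ0 hQn (by linarith)
  have hne : ∀ a : ℝ, ∀ᵐ x ∂(volume.restrict (dom L)), x ≠ a := fun a =>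
    ae_restrict_of_ae (by simp [ae_iff])
  filter_upwards [hw, hne (-L), hne L, ae_restrict_mem measurableSet_Ioo] with x hx hx1 hx2 hxd
  have hxl : -2 * L < x := hxd.1
  have hxr : x < 2 * L := hxd.2
  rw [hx]
  unfold step
  split_ifs with hlt hle
  · have h4 := hPl x hxl.le hlt
    have h5 := hQr (-x) (by linarith)
    simp only [neg_neg] at h5
    linarith
  · have h4 := hPr x (lt_of_le_of_ne (not_lt.1 hlt) (Ne.symm hx1))
    have h5 := hQr (-x) (by linarith [lt_of_le_of_ne hle hx2])
    simp only [neg_neg] at h5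
    linarith
  · have h4 := hPr x (lt_of_le_of_ne (not_lt.1 hlt) (Ne.symm hx1))
    have h5 := hQl (-x) (by linarith) (by linarith [not_le.1 hle])
    simp only [neg_neg] at h5
    linarith

/-! ### The fidelity term as a Huber loss -/

/-- The Huber function, that is, the infimal convolution of `l₁ |·|` and `l₂ / 2 (·)²`. -/
def huber (l₁ l₂ t : ℝ) : ℝ :=
  if |t| ≤ l₁ / l₂ then l₂ / 2 * t ^ 2 else l₁ * |t| - l₁ ^ 2 / (2 * l₂)

lemma measurable_huber (l₁ l₂ : ℝ) : Measurable (huber l₁ l₂) :=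
  Measurable.ite (measurableSet_le (by fun_prop) measurable_const) (by fun_prop) (by fun_prop)

lemma huber_le {l₁ l₂ : ℝ} (hl₁ : 0 < l₁) (hl₂ : 0 < l₂) (t v : ℝ) :
    huber l₁ l₂ t ≤ l₁ * |v| + l₂ / 2 * (t - v) ^ 2 := by
  unfold huber
  split_ifs with h
  · rw [le_div_iff₀ hl₂] at h
    have h1 : t * v ≤ |t| * |v| := by rw [← abs_mul]; exact le_abs_self _
    have h2 : |t| * l₂ * |v| ≤ l₁ * |v| := mul_le_mul_of_nonneg_right h (abs_nonneg v)
    nlinarith [sq_nonneg v, mul_le_mul_of_nonneg_left h1 hl₂.le]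
  · have h1 : |t| - |t - v| ≤ |v| := by
      have := abs_sub_abs_le_abs_sub t (t - v)
      rwa [sub_sub_cancel] at this
    have h2 : l₁ ^ 2 / (2 * l₂) + l₂ / 2 * (t - v) ^ 2 - l₁ * |t - v|
        = l₂ / 2 * (|t - v| - l₁ / l₂) ^ 2 := by
      rw [← sq_abs (t - v)]
      field_simp
      ring
    have h3 : 0 ≤ l₂ / 2 * (|t - v| - l₁ / l₂) ^ 2 := by positivity
    nlinarith [mul_le_mul_of_nonneg_left h1 hl₁.le]

lemma huber_nonneg {l₁ l₂ : ℝ} (hl₁ : 0 < l₁) (hl₂ : 0 < l₂) (t : ℝ) : 0 ≤ huber l₁ l₂ t := by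
  unfold huber
  split_ifs with h
  · positivity
  · have h1 : l₁ * (l₁ / l₂) ≤ l₁ * |t| := mul_le_mul_of_nonneg_left (not_le.1 h).le hl₁.le
    have h2 : l₁ ^ 2 / (2 * l₂) = l₁ * (l₁ / l₂) / 2 := by field_simp
    have h3 : 0 < l₁ * (l₁ / l₂) := by positivity
    linarith

lemma huber_neg (l₁ l₂ t : ℝ) : huber l₁ l₂ (-t) = huber l₁ l₂ t := by
  simp [huber]

/-- The gap between the Huber function and its tangent line at a point `σ` of its quadratic part is
nonnegative. If it is zero at `t`, then `σ ≤ t`, and even `t = σ` unless `σ` is the end point of the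
quadratic part. -/
lemma huber_tangent {l₁ l₂ σ : ℝ} (hl₁ : 0 < l₁) (hl₂ : 0 < l₂) (hσ : 0 < σ) (hσl : l₂ * σ ≤ l₁)
    (t : ℝ) : 0 ≤ huber l₁ l₂ t - (l₂ * σ * t - l₂ * σ ^ 2 / 2) ∧
      (huber l₁ l₂ t - (l₂ * σ * t - l₂ * σ ^ 2 / 2) = 0 →
        σ ≤ t ∧ (l₂ * σ < l₁ → t = σ)) := by
  obtain ⟨τ, rfl⟩ : ∃ τ, l₁ = l₂ * τ := ⟨l₁ / l₂, by field_simp⟩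
  have hστ : σ ≤ τ := le_of_mul_le_mul_left hσl hl₂
  have hτ : 0 < τ := hσ.trans_le hστ
  unfold huber
  rw [mul_div_cancel_left₀ _ hl₂.ne']
  split_ifs with h
  · have e : l₂ / 2 * t ^ 2 - (l₂ * σ * t - l₂ * σ ^ 2 / 2) = l₂ / 2 * (t - σ) ^ 2 := by ring
    rw [e]
    refine ⟨by positivity, fun h0 => ?_⟩
    have : t = σ := by
      rcases mul_eq_zero.1 h0 with h1 | h1
      · linarith
      · exact sub_eq_zero.1 (pow_eq_zero_iff two_ne_zero |>.1 h1)
    exact ⟨this.ge, fun _ => this⟩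
  · have ht := not_le.1 h
    have e : l₂ * τ * |t| - (l₂ * τ) ^ 2 / (2 * l₂) - (l₂ * σ * t - l₂ * σ ^ 2 / 2)
        = l₂ * (τ * |t| - τ ^ 2 / 2 - σ * t + σ ^ 2 / 2) := by
      field_simp
      ring
    rw [e]
    rcases le_or_gt 0 t with h0 | h0
    · rw [abs_of_nonneg h0] at ht ⊢
      have e2 : τ * t - τ ^ 2 / 2 - σ * t + σ ^ 2 / 2 = (τ - σ) * (t - (τ + σ) / 2) := by ring
      have hpos : 0 < t - (τ + σ) / 2 := by linarith
      rw [e2]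
      refine ⟨mul_nonneg hl₂.le (mul_nonneg (by linarith) hpos.le), fun hz => ?_⟩
      have : τ - σ = 0 := by
        rcases mul_eq_zero.1 hz with h1 | h1
        · exact absurd h1 hl₂.ne'
        · exact (mul_eq_zero.1 h1).resolve_right hpos.ne'
      refine ⟨by linarith, fun hlt => ?_⟩
      have := lt_of_mul_lt_mul_left hlt hl₂.le
      linarith
    · rw [abs_of_neg h0] at ht ⊢
      have hpos : 0 < τ * -t - τ ^ 2 / 2 - σ * t + σ ^ 2 / 2 := by nlinarith
      exact ⟨(mul_pos hl₂ hpos).le, fun hz => absurd hz (mul_pos hl₂ hpos).ne'⟩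

lemma fidelity_term_eq {Ω : Set ℝ} {l₁ l₂ : ℝ} (hl₁ : 0 < l₁) (hl₂ : 0 < l₂) {v : ℝ → ℝ}
    (hv : AEStronglyMeasurable v (volume.restrict Ω)) (g : ℝ → ℝ) :
    ENNReal.ofReal l₁ * eLpNorm v 1 (volume.restrict Ω) +
      ENNReal.ofReal (l₂ / 2) * eLpNorm g 2 (volume.restrict Ω) ^ 2
      = ∫⁻ x in Ω, ENNReal.ofReal (l₁ * |v x| + l₂ / 2 * g x ^ 2) := by
  have h2 : eLpNorm g 2 (volume.restrict Ω) ^ 2 = ∫⁻ x in Ω, ‖g x‖ₑ ^ 2 := by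
    have := eLpNorm_nnreal_pow_eq_lintegral (f := g) (μ := volume.restrict Ω) (p := 2) two_ne_zero
    simpa using this
  rw [h2, eLpNorm_one_eq_lintegral_enorm, ← lintegral_const_mul' _ _ ENNReal.ofReal_ne_top,
    ← lintegral_const_mul' _ _ ENNReal.ofReal_ne_top,
    ← lintegral_add_left' (hv.enorm.const_mul _)]
  congr 1 with x
  rw [ENNReal.ofReal_add (by positivity) (by positivity), ENNReal.ofReal_mul hl₁.le,
    ENNReal.ofReal_mul (by positivity), Real.enorm_eq_ofReal_abs, Real.enorm_eq_ofReal_abs,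
    ← ENNReal.ofReal_pow (abs_nonneg _), sq_abs]

lemma lintegral_huber_le_fidelity (Ω : Set ℝ) {l₁ l₂ : ℝ} (hl₁ : 0 < l₁) (hl₂ : 0 < l₂)
    (u f : ℝ → ℝ) :
    ∫⁻ x in Ω, ENNReal.ofReal (huber l₁ l₂ (f x - u x)) ≤ fidelity Ω l₁ l₂ u f := by
  refine le_iInf₂ fun v hv => ?_
  rw [fidelity_term_eq hl₁ hl₂ hv.1]
  exact lintegral_mono fun x => ENNReal.ofReal_le_ofReal (huber_le hl₁ hl₂ _ _)

/-! ### The lower bound for the energy -/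

lemma integrableOn_huber {L h l₁ l₂ : ℝ} (hl₁ : 0 < l₁) (hl₂ : 0 < l₂) {w : ℝ → ℝ}
    (hw : IntegrableOn w (dom L)) :
    IntegrableOn (fun x => huber l₁ l₂ (data L h x - w x)) (dom L) := by
  have hd : IntegrableOn (fun x => data L h x - w x) (dom L) := (integrableOn_step L 0 h 0).sub hw
  refine (hd.abs.const_mul l₁).mono'
    ((measurable_huber l₁ l₂).comp_aemeasurable hd.aemeasurable).aestronglyMeasurable
    (Eventually.of_forall fun x => ?_)
  rw [Real.norm_of_nonneg (huber_nonneg hl₁ hl₂ _)]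
  simpa using huber_le hl₁ hl₂ (data L h x - w x) (data L h x - w x)

/-- The minimal energy, when the dual certificate has slope `l₂ * σ`. -/
def minEnergy (L h l₂ σ : ℝ) : ℝ := 2 * L * h * (l₂ * σ) - 2 * L * l₂ * σ ^ 2

/-- The bound for the fidelity term that the tangent lines of the Huber function give, with the case
of equality. -/
lemma integral_huber_bound {L h l₁ l₂ σ : ℝ} (hL : 0 < L) (hl₁ : 0 < l₁) (hl₂ : 0 < l₂)
    (hσ : 0 < σ) (hσl : l₂ * σ ≤ l₁) {w : ℝ → ℝ} (hw : IntegrableOn w (dom L)) :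
    minEnergy L h l₂ σ - l₂ * σ * contrast L w
        ≤ ∫ x in dom L, huber l₁ l₂ (data L h x - w x) ∧
      (∫ x in dom L, huber l₁ l₂ (data L h x - w x)
          ≤ minEnergy L h l₂ σ - l₂ * σ * contrast L w →
        ∀ᵐ x ∂volume.restrict (dom L), σ ≤ sign L x * (data L h x - w x) ∧
          (l₂ * σ < l₁ → sign L x * (data L h x - w x) = σ)) := by
  have hH := integrableOn_huber (h := h) hl₁ hl₂ hw
  let q : ℝ → ℝ := fun x => step L (-(l₂ * σ ^ 2 / 2)) (l₂ * σ * h - l₂ * σ ^ 2 / 2)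
    (-(l₂ * σ ^ 2 / 2)) x - l₂ * σ * (sign L x * w x)
  have hq : ∀ x, q x = l₂ * σ * (sign L x * (data L h x - w x)) - l₂ * σ ^ 2 / 2 := by
    intro x
    simp only [q, sign, data, step]
    split_ifs <;> ring
  have hsw : IntegrableOn (fun x => sign L x * w x) (dom L) := integrableOn_step_mul _ _ _ hw
  have hqi : IntegrableOn q (dom L) := (integrableOn_step L _ _ _).sub (hsw.const_mul _)
  have hqI : ∫ x in dom L, q x = minEnergy L h l₂ σ - l₂ * σ * contrast L w := by
    simp only [q]
    rw [integral_sub (integrableOn_step L _ _ _) (hsw.const_mul _), setIntegral_step hL,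
      integral_const_mul, contrast, minEnergy]
    ring
  have hsign : ∀ x, huber l₁ l₂ (data L h x - w x)
      = huber l₁ l₂ (sign L x * (data L h x - w x)) := by
    intro x
    simp only [sign, step]
    split_ifs <;> simp only [neg_one_mul, one_mul, huber_neg]
  have hgap := fun x => huber_tangent hl₁ hl₂ hσ hσl (sign L x * (data L h x - w x))
  have hnn : ∀ x, 0 ≤ huber l₁ l₂ (data L h x - w x) - q x := fun x => by
    rw [hsign, hq]
    exact (hgap x).1
  have hI := integral_sub hH hqi
  have hI0 : 0 ≤ ∫ x in dom L, (huber l₁ l₂ (data L h x - w x) - q x) :=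
    integral_nonneg hnn
  refine ⟨by linarith, fun hle => ?_⟩
  have hz : ∫ x in dom L, (huber l₁ l₂ (data L h x - w x) - q x) = 0 := by linarith
  filter_upwards [(integral_eq_zero_iff_of_nonneg hnn (hH.sub hqi)).1 hz] with x hx
  refine (hgap x).2 ?_
  rw [← hsign, ← hq]
  exact hx

lemma exists_ae_mem_Ioo {Ω : Set ℝ} {p : ℝ → Prop} (hp : ∀ᵐ x ∂volume.restrict Ω, p x) {a b : ℝ}
    (hab : a < b) (hsub : Ioo a b ⊆ Ω) : ∃ x ∈ Ioo a b, p x := by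
  have h1 := ae_restrict_of_ae_restrict_of_subset hsub hp
  have h2 : ∀ᵐ x ∂volume.restrict (Ioo a b), x ∈ Ioo a b := ae_restrict_mem measurableSet_Ioo
  have : (ae (volume.restrict (Ioo a b))).NeBot := by
    rw [ae_neBot, Ne, Measure.restrict_eq_zero, Real.volume_Ioo, ENNReal.ofReal_eq_zero]
    linarith
  exact (h2.and h1).exists

lemma exists_values_of_ae {L : ℝ} (hL : 0 < L) {p : ℝ → Prop}
    (hp : ∀ᵐ x ∂volume.restrict (dom L), p x) :
    (∃ x, x < -L ∧ p x) ∧ (∃ x, ¬ x < -L ∧ x ≤ L ∧ p x) ∧ ∃ x, ¬ x < -L ∧ ¬ x ≤ L ∧ p x := by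
  obtain ⟨x, hx, hpx⟩ := exists_ae_mem_Ioo hp (a := -2 * L) (b := -L) (by linarith)
    (Ioo_subset_Ioo le_rfl (by linarith))
  obtain ⟨y, hy, hpy⟩ := exists_ae_mem_Ioo hp (a := -L) (b := L) (by linarith)
    (Ioo_subset_Ioo (by linarith) (by linarith))
  obtain ⟨z, hz, hpz⟩ := exists_ae_mem_Ioo hp (a := L) (b := 2 * L) (by linarith)
    (Ioo_subset_Ioo (by linarith) le_rfl)
  exact ⟨⟨x, hx.2, hpx⟩, ⟨y, not_lt.2 hy.1.le, hy.2.le, hpy⟩,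
    ⟨z, not_lt.2 (by linarith [hz.1]), not_le.2 hz.1, hpz⟩⟩

/-- The levels `(c₁, m, c₂)` of the step functions for which the lower bound for the energy with
parameter `σ` is attained. The slope of the dual certificate is `l₂ * σ`. Where it is below the
maximal slope `l₁` of the Huber function, the fidelity term fixes the levels; where the certificate
stays below the value `1` that the total variation allows, there are no jumps. -/
structure Optimal (L h l₁ l₂ σ c₁ m c₂ : ℝ) : Prop where
  le_left : σ ≤ c₁
  le_right : σ ≤ c₂
  left_le : c₁ ≤ m
  right_le : c₂ ≤ m
  le_sub : m ≤ h - σ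
  eq_of_slope_lt : l₂ * σ < l₁ → c₁ = σ ∧ m = h - σ ∧ c₂ = σ
  eq_of_peak_lt : l₂ * σ * L < 1 → c₁ = m ∧ c₂ = m

/-- Weak duality, with the case of equality. -/
lemma energy_bound {L h l₁ l₂ σ : ℝ} (hL : 0 < L) (hl₁ : 0 < l₁) (hl₂ : 0 < l₂)
    (hσ : 0 < σ) (hσl : l₂ * σ ≤ l₁) (hσL : l₂ * σ * L ≤ 1) {w : ℝ → ℝ} (hw : IsBV (dom L) w) :
    ENNReal.ofReal (minEnergy L h l₂ σ) ≤ energy (dom L) l₁ l₂ (data L h) w ∧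
      (energy (dom L) l₁ l₂ (data L h) w ≤ ENNReal.ofReal (minEnergy L h l₂ σ) →
        0 ≤ minEnergy L h l₂ σ →
        ∃ c₁ m c₂, Optimal L h l₁ l₂ σ c₁ m c₂ ∧
          w =ᵐ[volume.restrict (dom L)] step L c₁ m c₂) := by
  obtain ⟨hw1, μ, hμ⟩ := hw
  have hwi : IntegrableOn w (dom L) := memLp_one_iff_integrable.1 hw1
  obtain ⟨c, hc⟩ := hμ.ae_eq_leftMass (by linarith) hwi
  set A := μ.toJordanDecomposition.posPart
  set B := μ.toJordanDecomposition.negPart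
  set p := A.real (Ioo (-2 * L) (2 * L))
  set n := B.real (Ioo (-2 * L) (2 * L))
  set P := leftMass (Ioo (-2 * L) (2 * L)) A
  set N := leftMass (Ioo (-2 * L) (2 * L)) B
  have hp0 : 0 ≤ p := measureReal_nonneg
  have hn0 : 0 ≤ n := measureReal_nonneg
  have hle := contrast_le_of_ae_eq hL hc (leftMass_monotone _ A) (leftMass_nonneg _ A)
    (leftMass_le _ A) (leftMass_monotone _ B) (leftMass_nonneg _ B) (leftMass_le _ B)
  have hstep := ae_eq_step_of_contrast_eq hL hc (leftMass_monotone _ A) (leftMass_nonneg _ A)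
    (leftMass_le _ A) (leftMass_monotone _ B) (leftMass_nonneg _ B) (leftMass_le _ B)
  change contrast L w ≤ L * (p + n) at hle
  change contrast L w = L * (p + n) → w =ᵐ[volume.restrict (dom L)] step L c (c + p) (c + p - n)
    at hstep
  have hvar : variation (dom L) w = ENNReal.ofReal (p + n) := by
    rw [variation_eq (isOpen_dom L) hμ, ENNReal.ofReal_add hp0 hn0, ofReal_measureReal,
      ofReal_measureReal]
    rfl
  have hHi := integrableOn_huber (h := h) hl₁ hl₂ hwi
  have hHn : 0 ≤ᵐ[volume.restrict (dom L)] fun x => huber l₁ l₂ (data L h x - w x) :=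
    Eventually.of_forall fun x => huber_nonneg hl₁ hl₂ _
  set H := ∫ x in dom L, huber l₁ l₂ (data L h x - w x)
  have hH0 : 0 ≤ H := integral_nonneg fun x => huber_nonneg hl₁ hl₂ _
  have hE : ENNReal.ofReal (p + n + H) ≤ energy (dom L) l₁ l₂ (data L h) w := by
    rw [energy, hvar, ENNReal.ofReal_add (by positivity) hH0,
      ofReal_integral_eq_lintegral_ofReal hHi hHn]
    gcongr
    exact lintegral_huber_le_fidelity _ hl₁ hl₂ _ _
  obtain ⟨hb, hbeq⟩ := integral_huber_bound (h := h) hL hl₁ hl₂ hσ hσl hwi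
  change minEnergy L h l₂ σ - l₂ * σ * contrast L w ≤ H at hb
  have hs : 0 < l₂ * σ := mul_pos hl₂ hσ
  have h1 : l₂ * σ * contrast L w ≤ l₂ * σ * L * (p + n) := by
    rw [mul_assoc _ L]
    exact mul_le_mul_of_nonneg_left hle hs.le
  have h2 : l₂ * σ * L * (p + n) ≤ p + n := mul_le_of_le_one_left (by positivity) hσL
  refine ⟨(ENNReal.ofReal_le_ofReal (by linarith)).trans hE, fun hEle hm0 => ?_⟩
  have h3 : p + n + H ≤ minEnergy L h l₂ σ :=
    (ENNReal.ofReal_le_ofReal_iff hm0).1 (hE.trans hEle)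
  have hX : contrast L w = L * (p + n) := by
    have : l₂ * σ * contrast L w = l₂ * σ * (L * (p + n)) := by
      rw [← mul_assoc]
      linarith
    exact mul_left_cancel₀ hs.ne' this
  have hw' := hstep hX
  refine ⟨c, c + p, c + p - n, ?_, hw'⟩
  have hae : ∀ᵐ x ∂volume.restrict (dom L),
      σ ≤ sign L x * (data L h x - step L c (c + p) (c + p - n) x) ∧
        (l₂ * σ < l₁ → sign L x * (data L h x - step L c (c + p) (c + p - n) x) = σ) := by
    filter_upwards [hbeq (by linarith), hw'] with x hx hxw
    rwa [← hxw]
  obtain ⟨⟨x, hx, hx1, hx2⟩, ⟨y, hy, hy', hy1, hy2⟩, ⟨z, hz, hz', hz1, hz2⟩⟩ :=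
    exists_values_of_ae hL hae
  simp only [sign, data, step, if_pos hx] at hx1 hx2
  simp only [sign, data, step, if_neg hy, if_pos hy'] at hy1 hy2
  simp only [sign, data, step, if_neg hz, if_neg hz'] at hz1 hz2
  refine ⟨by linarith, by linarith, by linarith, by linarith, by linarith, fun hlt => ?_,
    fun hlt => ?_⟩
  · have := hx2 hlt
    have := hy2 hlt
    have := hz2 hlt
    refine ⟨by linarith, by linarith, by linarith⟩
  · have h4 : (1 - l₂ * σ * L) * (p + n) = 0 := by
      have : l₂ * σ * contrast L w = l₂ * σ * L * (p + n) := by rw [hX]; ring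
      linarith
    have h5 : p + n = 0 := (mul_eq_zero.1 h4).resolve_left (by linarith)
    constructor <;> linarith

/-! ### Attainment by step functions -/

/-- The Jordan decomposition of the measure with mass `a` at `-L` and mass `-b` at `L`. -/
def jumps {L : ℝ} (hL : 0 < L) (a b : ℝ) : JordanDecomposition ℝ where
  posPart := a.toNNReal • Measure.dirac (-L)
  negPart := b.toNNReal • Measure.dirac L
  mutuallySingular := by
    refine ⟨{L}, measurableSet_singleton L, ?_, ?_⟩
    · have : -L ≠ L := by linarith
      simp [this]
    · simp

lemma leftMass_smul_dirac {Ω : Set ℝ} (hΩ : MeasurableSet Ω) {y : ℝ} (hy : y ∈ Ω) {a : ℝ}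
    (ha : 0 ≤ a) (x : ℝ) :
    leftMass Ω (a.toNNReal • Measure.dirac y) x = if y ≤ x then a else 0 := by
  rw [leftMass, measureReal_def, Measure.restrict_apply' hΩ, Measure.smul_apply,
    Measure.dirac_apply' _ (measurableSet_Iic.inter hΩ)]
  by_cases hyx : y ≤ x <;> simp [hyx, hy, ha, ENNReal.smul_def]

lemma step_ae_eq_leftMass {L : ℝ} (hL : 0 < L) (c : ℝ) {a b : ℝ} (ha : 0 ≤ a) (hb : 0 ≤ b) :
    (fun x => c + leftMass (dom L) (jumps hL a b).posPart x
      - leftMass (dom L) (jumps hL a b).negPart x)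
      =ᵐ[volume.restrict (dom L)] step L c (c + a) (c + a - b) := by
  have hne : ∀ᵐ x ∂(volume.restrict (dom L)), x ≠ L := ae_restrict_of_ae (by simp [ae_iff])
  filter_upwards [hne] with x hx
  have h1 : -L ∈ dom L := ⟨by linarith, by linarith⟩
  have h2 : L ∈ dom L := ⟨by linarith, by linarith⟩
  simp only [jumps]
  rw [leftMass_smul_dirac (isOpen_dom L).measurableSet h1 ha, leftMass_smul_dirac (isOpen_dom L).measurableSet h2 hb]
  unfold step
  rcases lt_or_ge x (-L) with h3 | h3
  · have h4 : ¬ L ≤ x := by linarith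
    simp [h3, not_le.2 h3, h4]
  · rcases lt_or_gt_of_ne hx with h4 | h4
    · simp [not_lt.2 h3, h3, h4.le, not_le.2 h4]
    · simp [not_lt.2 h3, h3, h4.le, not_le.2 h4]

/-- A function with a step up at `-L` and a step down at `L` has bounded variation, and its total
variation is at most the sum of the heights of the steps. -/
lemma isBV_of_ae_eq_step {L : ℝ} (hL : 0 < L) {u : ℝ → ℝ} {c₁ m c₂ : ℝ} (h₁ : c₁ ≤ m)
    (h₂ : c₂ ≤ m) (hu : u =ᵐ[volume.restrict (dom L)] step L c₁ m c₂) :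
    IsBV (dom L) u ∧ variation (dom L) u ≤ ENNReal.ofReal (2 * m - c₁ - c₂) := by
  set j := jumps hL (m - c₁) (m - c₂) with hj
  have hjd : j.toSignedMeasure.toJordanDecomposition = j :=
    JordanDecomposition.toJordanDecomposition_toSignedMeasure j
  have hd : IsDistribDeriv (dom L) u j.toSignedMeasure := by
    have h := isDistribDeriv_leftMass (Ω := dom L) c₁ j.toSignedMeasure
    rw [hjd] at h
    refine h.congr_ae ?_
    have h3 := step_ae_eq_leftMass hL c₁ (sub_nonneg.2 h₁) (sub_nonneg.2 h₂)
    rw [show c₁ + (m - c₁) = m by ring, sub_sub_cancel] at h3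
    exact h3.trans hu.symm
  refine ⟨⟨memLp_one_iff_integrable.2 ((integrableOn_step L c₁ m c₂).congr hu.symm), _, hd⟩, ?_⟩
  refine (iInf₂_le _ hd).trans ?_
  have h1 : -L ∈ dom L := ⟨by linarith, by linarith⟩
  have h2 : L ∈ dom L := ⟨by linarith, by linarith⟩
  rw [SignedMeasure.totalVariation, hjd, show 2 * m - c₁ - c₂ = (m - c₁) + (m - c₂) by ring,
    ENNReal.ofReal_add (by linarith) (by linarith)]
  rw [hj]
  simp [jumps, h1, h2, ENNReal.ofReal]

/-- For optimal levels, the infimum in the fidelity term is bounded by its value at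
`v = f - u - σ` on `[-L, L]` and `v = f - u + σ` elsewhere. -/
lemma fidelity_le_of_ae_eq_step {L h l₁ l₂ σ : ℝ} (hL : 0 < L) (hl₁ : 0 < l₁) (hl₂ : 0 < l₂)
    {u : ℝ → ℝ} {c₁ m c₂ : ℝ} (ho : Optimal L h l₁ l₂ σ c₁ m c₂)
    (hu : u =ᵐ[volume.restrict (dom L)] step L c₁ m c₂) :
    fidelity (dom L) l₁ l₂ u (data L h) ≤
      ENNReal.ofReal (L * (l₁ * (c₁ + c₂ - 2 * m + 2 * h - 4 * σ) + 2 * l₂ * σ ^ 2)) := by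
  set v := step L (σ - c₁) (h - m - σ) (σ - c₂)
  have hv : MemLp v 1 (volume.restrict (dom L)) :=
    memLp_one_iff_integrable.2 (integrableOn_step L _ _ _)
  refine (iInf₂_le v hv).trans ?_
  rw [fidelity_term_eq hl₁ hl₂ hv.1]
  set F := step L (l₁ * (c₁ - σ) + l₂ / 2 * σ ^ 2) (l₁ * (h - m - σ) + l₂ / 2 * σ ^ 2)
    (l₁ * (c₂ - σ) + l₂ / 2 * σ ^ 2)
  have hval : ∀ x, l₁ * |v x| + l₂ / 2 * (data L h x - step L c₁ m c₂ x - v x) ^ 2 = F x := by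
    intro x
    have e1 : |σ - c₁| = c₁ - σ := by
      rw [abs_sub_comm, abs_of_nonneg (sub_nonneg.2 ho.le_left)]
    have e2 : |σ - c₂| = c₂ - σ := by
      rw [abs_sub_comm, abs_of_nonneg (sub_nonneg.2 ho.le_right)]
    have e3 : |h - m - σ| = h - m - σ := abs_of_nonneg (by linarith [ho.le_sub])
    simp only [v, F, data, step]
    split_ifs <;> simp only [e1, e2, e3] <;> ring
  have hF0 : ∀ x, 0 ≤ F x := fun x => by
    rw [← hval x]
    positivity
  have hle : ∫⁻ x in dom L, ENNReal.ofReal (l₁ * |v x| + l₂ / 2 * (data L h x - u x - v x) ^ 2)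
      = ∫⁻ x in dom L, ENNReal.ofReal (F x) := by
    refine lintegral_congr_ae ?_
    filter_upwards [hu] with x hx
    rw [hx, hval]
  rw [hle, ← ofReal_integral_eq_lintegral_ofReal (integrableOn_step L _ _ _)
    (Eventually.of_forall hF0), setIntegral_step hL]
  refine ENNReal.ofReal_le_ofReal (le_of_eq ?_)
  ring

lemma energy_le_of_optimal {L h l₁ l₂ σ : ℝ} (hL : 0 < L) (hl₁ : 0 < l₁) (hl₂ : 0 < l₂)
    (hσl : l₂ * σ ≤ l₁) (hσL : l₂ * σ * L ≤ 1)
    {u : ℝ → ℝ} {c₁ m c₂ : ℝ} (ho : Optimal L h l₁ l₂ σ c₁ m c₂)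
    (hu : u =ᵐ[volume.restrict (dom L)] step L c₁ m c₂) :
    energy (dom L) l₁ l₂ (data L h) u ≤ ENNReal.ofReal (minEnergy L h l₂ σ) := by
  have h1 : c₁ ≤ m := ho.left_le
  have h2 : c₂ ≤ m := ho.right_le
  have h3 := ho.le_left
  have h4 := ho.le_right
  have h5 := ho.le_sub
  have hfid : 0 ≤ L * (l₁ * (c₁ + c₂ - 2 * m + 2 * h - 4 * σ) + 2 * l₂ * σ ^ 2) := by
    have : 0 ≤ c₁ + c₂ - 2 * m + 2 * h - 4 * σ := by linarith
    positivity
  refine (add_le_add (isBV_of_ae_eq_step hL h1 h2 hu).2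
    (fidelity_le_of_ae_eq_step hL hl₁ hl₂ ho hu)).trans ?_
  rw [← ENNReal.ofReal_add (by linarith) hfid]
  refine ENNReal.ofReal_le_ofReal (le_of_eq ?_)
  -- the slope of the certificate agrees with `l₁` where it meets a nonzero factor
  have e1 : l₁ * (c₁ + c₂ - 2 * m + 2 * h - 4 * σ)
      = l₂ * σ * (c₁ + c₂ - 2 * m + 2 * h - 4 * σ) := by
    rcases hσl.lt_or_eq with hlt | heq
    · obtain ⟨r1, r2, r3⟩ := ho.eq_of_slope_lt hlt
      rw [r1, r2, r3]
      ring
    · rw [heq]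
  have e2 : 2 * m - c₁ - c₂ = l₂ * σ * L * (2 * m - c₁ - c₂) := by
    rcases hσL.lt_or_eq with hlt | heq
    · obtain ⟨r1, r2⟩ := ho.eq_of_peak_lt hlt
      rw [r1, r2]
      ring
    · rw [heq, one_mul]
  rw [e1, e2, minEnergy]
  ring

/-- Once the levels of some step function are optimal, the solutions are exactly the step functions
with optimal levels. -/
lemma mem_solutions_iff {L h l₁ l₂ σ : ℝ} (hL : 0 < L) (hl₁ : 0 < l₁) (hl₂ : 0 < l₂)
    (hσ : 0 < σ) (hσl : l₂ * σ ≤ l₁) (hσL : l₂ * σ * L ≤ 1)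
    (hex : ∃ c₁ m c₂, Optimal L h l₁ l₂ σ c₁ m c₂) (u : Lp ℝ 1 (volume.restrict (dom L))) :
    u ∈ solutions (dom L) l₁ l₂ (data L h) ↔
      ∃ c₁ m c₂, Optimal L h l₁ l₂ σ c₁ m c₂ ∧
        u =ᵐ[volume.restrict (dom L)] step L c₁ m c₂ := by
  constructor
  · rintro ⟨hu, hmin⟩
    obtain ⟨c₁, m, c₂, ho⟩ := hex
    refine (energy_bound hL hl₁ hl₂ hσ hσl hσL hu).2 ?_ ?_
    · exact (hmin _ (isBV_of_ae_eq_step hL ho.left_le ho.right_le EventuallyEq.rfl).1).trans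
        (energy_le_of_optimal hL hl₁ hl₂ hσl hσL ho EventuallyEq.rfl)
    · have h1 : 0 ≤ h - σ := by linarith [ho.le_left, ho.left_le, ho.le_sub]
      have e : minEnergy L h l₂ σ = 2 * L * (l₂ * σ) * (h - σ) := by
        rw [minEnergy]
        ring
      rw [e]
      positivity
  · rintro ⟨c₁, m, c₂, ho, hu⟩
    exact ⟨(isBV_of_ae_eq_step hL ho.left_le ho.right_le hu).1, fun w hw =>
      (energy_le_of_optimal hL hl₁ hl₂ hσl hσL ho hu).trans
        (energy_bound hL hl₁ hl₂ hσ hσl hσL hw).1⟩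

/-! ### Solutions as elements of `L¹` -/

lemma step_self (L c : ℝ) : step L c c c = fun _ => c := by
  funext x
  unfold step
  split_ifs <;> rfl

/-- The class in `L¹` of a step function. -/
def stepLp (L a b c : ℝ) : Lp ℝ 1 (volume.restrict (dom L)) :=
  MemLp.toLp (step L a b c) (memLp_one_iff_integrable.2 (integrableOn_step L a b c))

lemma coeFn_stepLp (L a b c : ℝ) :
    stepLp L a b c =ᵐ[volume.restrict (dom L)] step L a b c := MemLp.coeFn_toLp _

lemma infinite_of_constants_mem {L : ℝ} (hL : 0 < L) {a b : ℝ} (hab : a < b)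
    {S : Set (Lp ℝ 1 (volume.restrict (dom L)))}
    (hS : ∀ c, a ≤ c → c ≤ b → stepLp L c c c ∈ S) : S.Infinite := by
  have hinj : Function.Injective fun c => stepLp L c c c := by
    intro c d hcd
    have hcd' : stepLp L c c c = stepLp L d d d := hcd
    have h1 := coeFn_stepLp L c c c
    rw [hcd'] at h1
    obtain ⟨⟨x, -, hx⟩, -⟩ := exists_values_of_ae hL (h1.symm.trans (coeFn_stepLp L d d d))
    simpa [step_self] using hx
  refine ((Icc_infinite hab).image hinj.injOn).mono ?_
  rintro _ ⟨c, hc, rfl⟩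
  exact hS c hc.1 hc.2

/-- Where the slope of the certificate is below `l₁`, the fidelity term alone fixes the solution. -/
lemma solutions_eq_singleton {L h l₁ l₂ σ : ℝ} (hL : 0 < L) (hl₁ : 0 < l₁) (hl₂ : 0 < l₂)
    (hσ : 0 < σ) (hσl : l₂ * σ < l₁) (hσL : l₂ * σ * L ≤ 1)
    (ho : Optimal L h l₁ l₂ σ σ (h - σ) σ) :
    solutions (dom L) l₁ l₂ (data L h) = {stepLp L σ (h - σ) σ} := by
  ext u
  rw [mem_solutions_iff hL hl₁ hl₂ hσ hσl.le hσL ⟨_, _, _, ho⟩, mem_singleton_iff]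
  constructor
  · rintro ⟨c₁, m, c₂, ho', hu⟩
    obtain ⟨rfl, rfl, rfl⟩ := ho'.eq_of_slope_lt hσl
    exact Lp.ext (hu.trans (coeFn_stepLp L _ _ _).symm)
  · rintro rfl
    exact ⟨_, _, _, ho, coeFn_stepLp L _ _ _⟩

/-! ### The four regimes -/

/-- If the certificate has the maximal slope `l₁`, then the solutions are infinitely many as soon as
there is more than one admissible constant. -/
lemma solutions_infinite {L h l₁ l₂ : ℝ} (hL : 0 < L) (hl₁ : 0 < l₁) (hl₂ : 0 < l₂)
    (hlL : l₁ * L ≤ 1) (hlt : l₁ / l₂ < h / 2) :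
    (solutions (dom L) l₁ l₂ (data L h)).Infinite := by
  have e : l₂ * (l₁ / l₂) = l₁ := mul_div_cancel₀ l₁ hl₂.ne'
  have ho : ∀ c, l₁ / l₂ ≤ c → c ≤ h - l₁ / l₂ → Optimal L h l₁ l₂ (l₁ / l₂) c c c :=
    fun c h1 h2 => ⟨h1, h1, le_rfl, le_rfl, h2, fun h3 => absurd h3 (by rw [e]; exact lt_irrefl _),
      fun _ => ⟨rfl, rfl⟩⟩
  refine infinite_of_constants_mem hL (a := l₁ / l₂) (b := h - l₁ / l₂) (by linarith)
    fun c h1 h2 => ?_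
  rw [mem_solutions_iff hL hl₁ hl₂ (div_pos hl₁ hl₂) e.le (by rwa [e])
    ⟨_, _, _, ho _ le_rfl (by linarith)⟩]
  exact ⟨c, c, c, ho c h1 h2, coeFn_stepLp L c c c⟩

end TVIC

end

theorem proposition3p1 (L h l₁ l₂ : ℝ) (hL : 0 < L) (hh : 0 < h) (hl₁ : 0 < l₁) (hl₂ : 0 < l₂) :
    -- (i) the constant `h / 2` is the unique solution
    (h / 2 < l₁ / l₂ → l₂ ≤ 2 / (h * L) →
      ∃ u, TVIC.solutions (TVIC.dom L) l₁ l₂ (TVIC.data L h) = {u} ∧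
        u =ᵐ[volume.restrict (TVIC.dom L)] fun _ => h / 2) ∧
    -- (ii) the solutions are exactly the constants in an interval
    (l₁ / l₂ ≤ h / 2 → l₁ < 1 / L →
      TVIC.solutions (TVIC.dom L) l₁ l₂ (TVIC.data L h) =
        {u : Lp ℝ 1 (volume.restrict (TVIC.dom L)) | ∃ c : ℝ, l₁ / l₂ ≤ c ∧ c ≤ h - l₁ / l₂ ∧
          u =ᵐ[volume.restrict (TVIC.dom L)] fun _ => c} ∧
      (TVIC.solutions (TVIC.dom L) l₁ l₂ (TVIC.data L h)).Nonempty ∧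
      (l₁ / l₂ < h / 2 → (TVIC.solutions (TVIC.dom L) l₁ l₂ (TVIC.data L h)).Infinite)) ∧
    -- (iii) the solutions are exactly a family of step functions
    (l₁ / l₂ ≤ h / 2 → l₁ = 1 / L →
      TVIC.solutions (TVIC.dom L) l₁ l₂ (TVIC.data L h) =
        {u : Lp ℝ 1 (volume.restrict (TVIC.dom L)) | ∃ c₁ c₂ d : ℝ, l₁ / l₂ ≤ c₁ ∧ l₁ / l₂ ≤ c₂ ∧ c₁ ≤ h - d ∧ c₂ ≤ h - d ∧
          h - d ≤ h - l₁ / l₂ ∧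
          u =ᵐ[volume.restrict (TVIC.dom L)] TVIC.step L c₁ (h - d) c₂} ∧
      (TVIC.solutions (TVIC.dom L) l₁ l₂ (TVIC.data L h)).Nonempty ∧
      (l₁ / l₂ < h / 2 → (TVIC.solutions (TVIC.dom L) l₁ l₂ (TVIC.data L h)).Infinite)) ∧
    -- (iv) a two-level step function is the unique solution
    (2 / (h * L) < l₂ → 1 / L < l₁ →
      ∃ u, TVIC.solutions (TVIC.dom L) l₁ l₂ (TVIC.data L h) = {u} ∧
        u =ᵐ[volume.restrict (TVIC.dom L)]
          TVIC.step L (1 / (L * l₂)) (h - 1 / (L * l₂)) (1 / (L * l₂))) := by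
  have hτ : 0 < l₁ / l₂ := div_pos hl₁ hl₂
  have e : l₂ * (l₁ / l₂) = l₁ := mul_div_cancel₀ l₁ hl₂.ne'
  have hslope : ¬ l₂ * (l₁ / l₂) < l₁ := by rw [e]; exact lt_irrefl _
  refine ⟨fun h1 h2 => ?_, fun h1 h2 => ?_, fun h1 h2 => ?_, fun h1 h2 => ?_⟩
  · rw [lt_div_iff₀ hl₂] at h1
    rw [le_div_iff₀ (by positivity)] at h2
    have e1 : h - h / 2 = h / 2 := by ring
    refine ⟨_, TVIC.solutions_eq_singleton (σ := h / 2) hL hl₁ hl₂ (by positivity) (by linarith)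
      (by linarith) ⟨le_rfl, le_rfl, e1.ge, e1.ge, le_rfl, fun _ => ⟨rfl, rfl, rfl⟩,
        fun _ => ⟨e1.symm, e1.symm⟩⟩, ?_⟩
    rw [e1, ← TVIC.step_self L (h / 2)]
    exact TVIC.coeFn_stepLp L _ _ _
  · have hlL : l₁ * L < 1 := (lt_div_iff₀ hL).1 h2
    have ho : ∀ c, l₁ / l₂ ≤ c → c ≤ h - l₁ / l₂ → TVIC.Optimal L h l₁ l₂ (l₁ / l₂) c c c :=
      fun c h3 h4 => ⟨h3, h3, le_rfl, le_rfl, h4, fun h5 => absurd h5 hslope,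
        fun _ => ⟨rfl, rfl⟩⟩
    have hmem := TVIC.mem_solutions_iff hL hl₁ hl₂ hτ e.le (by rw [e]; exact hlL.le)
      ⟨_, _, _, ho _ le_rfl (by linarith)⟩
    refine ⟨?_, ⟨_, (hmem _).2 ⟨_, _, _, ho _ le_rfl (by linarith), TVIC.coeFn_stepLp L _ _ _⟩⟩,
      TVIC.solutions_infinite hL hl₁ hl₂ hlL.le⟩
    ext u
    rw [hmem, mem_ofPred_eq]
    constructor
    · rintro ⟨c₁, m, c₂, hopt, hu⟩
      obtain ⟨rfl, rfl⟩ := hopt.eq_of_peak_lt (by rw [e]; exact hlL)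
      rw [TVIC.step_self] at hu
      exact ⟨_, hopt.le_left, hopt.le_sub, hu⟩
    · rintro ⟨c, h3, h4, hu⟩
      rw [← TVIC.step_self L c] at hu
      exact ⟨c, c, c, ho c h3 h4, hu⟩
  · have hlL : l₁ * L = 1 := by rw [h2, one_div, inv_mul_cancel₀ hL.ne']
    have hpeak : ¬ l₂ * (l₁ / l₂) * L < 1 := by rw [e, hlL]; exact lt_irrefl _
    have hmem := TVIC.mem_solutions_iff (h := h) hL hl₁ hl₂ hτ e.le (by rw [e]; exact hlL.le)
      ⟨l₁ / l₂, l₁ / l₂, l₁ / l₂, le_rfl, le_rfl, le_rfl, le_rfl, by linarith,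
        fun h3 => absurd h3 hslope, fun _ => ⟨rfl, rfl⟩⟩
    refine ⟨?_, ⟨_, (hmem _).2 ⟨l₁ / l₂, l₁ / l₂, l₁ / l₂, ⟨le_rfl, le_rfl, le_rfl, le_rfl,
      by linarith, fun h3 => absurd h3 hslope, fun _ => ⟨rfl, rfl⟩⟩,
      TVIC.coeFn_stepLp L _ _ _⟩⟩, TVIC.solutions_infinite hL hl₁ hl₂ hlL.le⟩
    ext u
    rw [hmem, mem_ofPred_eq]
    constructor
    · rintro ⟨c₁, m, c₂, hopt, hu⟩
      refine ⟨c₁, c₂, h - m, hopt.le_left, hopt.le_right, ?_, ?_, ?_, ?_⟩ <;> rw [sub_sub_cancel]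
      exacts [hopt.left_le, hopt.right_le, hopt.le_sub, hu]
    · rintro ⟨c₁, c₂, d, h3, h4, h5, h6, h7, hu⟩
      exact ⟨c₁, h - d, c₂, ⟨h3, h4, h5, h6, h7, fun h8 => absurd h8 hslope,
        fun h8 => absurd h8 hpeak⟩, hu⟩
  · have e1 : l₂ * (1 / (L * l₂)) = 1 / L := by field_simp
    have e2 : l₂ * (1 / (L * l₂)) * L = 1 := by field_simp
    have hle : 1 / (L * l₂) ≤ h - 1 / (L * l₂) := by
      have h3 : 2 < h * (L * l₂) := by
        rw [div_lt_iff₀ (by positivity)] at h1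
        linarith
      have h4 : 2 / (L * l₂) < h := (div_lt_iff₀ (by positivity)).2 h3
      have h5 : 2 / (L * l₂) = 1 / (L * l₂) + 1 / (L * l₂) := by ring
      linarith
    refine ⟨_, TVIC.solutions_eq_singleton (σ := 1 / (L * l₂)) hL hl₁ hl₂ (by positivity)
      (by rwa [e1]) e2.le ⟨le_rfl, le_rfl, hle, hle, le_rfl, fun _ => ⟨rfl, rfl, rfl⟩,
        fun h3 => absurd h3 (by rw [e2]; exact lt_irrefl _)⟩, TVIC.coeFn_stepLp L _ _ _⟩
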